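/- Let $\mathbb K\in\{\mathbb R,\mathbb C\}$, let $D$ be a nonempty set, let $B(D)$ be the Banach space of bounded functions $D\to\mathbb K$ with the sup-norm, let $\mathrm{APP}_\infty$ be the identity on $B(D)$, and let $F\subset B(D)$. The linear sampling numbers are $$g_m^{\rm lin}(\mathrm{APP}_\infty,F):=\inf_{\substack{x_1,\dots,x_m\in D\\ \phi_1,\dots,\phi_m\in B(D)}}\ \sup_{f\in F}\ \Big\|f-\sum_{i=1}^m f(x_i)\,\phi_i\Big\|_\infty .$$ A deterministic (adaptive) algorithm using $k$ linear measurements is a map $A=\varphi\circ N_k\colon F\to B(D)$ with an arbitrary map $\varphi\colon\mathbb K^k\to B(D)$ and $N_j(f)=(N_{j-1}(f),L_j(f))$ for $1\le j\le k$ (with $N_0$ empty), where the continuous linear functional $L_j=L_j(\,\cdot\,;N_{j-1}(f))\in B(D)'$ may depend arbitrarily on the previously observed values $N_{j-1}(f)$. A randomized algorithm using $k$ linear measurements is a family $(A^\omega)_{\omega\in\Omega}$ of such deterministic algorithms, indexed by a probability space $\Omega$, such that $(f,\omega)\mapsto\|f-A^\omega(f)\|_\infty$ is jointly measurable, where $F$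 carries the Borel $\sigma$-algebra of the topology given by the semi-norm with unit ball $F-F$. Let $$e_k^{\rm ran}(\mathrm{APP}_\infty,F):=\inf_{(A^\omega)}\ \sup_{f\in F}\ \mathbb E_\omega\,\|f-A^\omega(f)\|_\infty ,$$ where the infimum is over all randomized algorithms using $k$ linear measurements. All these quantities take values in $[0,\infty]$, with $0\cdot\infty=0$. **Theorem.** Let $n\ge 1$ be an integer. 1. If $F$ is convex and symmetric (that is, $cF\subset F$ for all $c\in\mathbb K$ with $|c|=1$; in the real case, $-F=F$), then $$g_{2n-1}^{\rm lin}(\mathrm{APP}_\infty,F)\ \le\ 6\,n\,\Big(\prod_{k=0}^{n-1}e_k^{\rm ran}(\mathrm{APP}_\infty,F)\Big)^{1/n}.$$ 2. If $F$ is the closed unit ball of a Hilbert space $H$ over $\mathbb K$ that is continuously embedded into $B(D)$, then $$g_{4n-1}^{\rm lin}(\mathrm{APP}_\infty,F)\ \le\ 6\,n^{1/2}\,\Big(\prod_{k=0}^{n-1}e_k^{\rm ran}(\mathrm{APP}_\infty,F)\Big)^{1/n}.$$ -/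

import Mathlib

open MeasureTheory
open scoped ENNReal

universe u₁ u₂ u₃ v w

/-- `B(D)`: the Banach space of bounded functions `D → 𝕜` with the sup-norm. -/
abbrev BddFun (𝕜 : Type*) [RCLike 𝕜] (D : Type*) : Type _ :=
  lp (fun _ : D => 𝕜) ∞

/-- `APP_∞`: the identity on `B(D)`. -/
noncomputable def appInfty (𝕜 : Type*) [RCLike 𝕜] (D : Type*) :
    BddFun 𝕜 D →L[𝕜] BddFun 𝕜 D :=
  ContinuousLinearMap.id 𝕜 (BddFun 𝕜 D)

/-- Symmetric sets: invariant under multiplication by scalars of modulus one,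
i.e. `F = -F` over the reals, and `F` circled over the complex numbers. -/
def SymmetricSet (𝕜 : Type*) [RCLike 𝕜] {X : Type*} [SMul 𝕜 X] (F : Set X) : Prop :=
  ∀ c : 𝕜, ‖c‖ = 1 → ∀ f ∈ F, c • f ∈ F

/-- The adaptive information mapping `N_n(f) = (N_{n-1}(f), L_n(f))`, where the functional
used in the next step may depend on the values observed so far:
`L k y` is the functional applied after the `k` values `y` have been observed. -/
def infoMap {𝕜 : Type*} [RCLike 𝕜] {X : Type*} [NormedAddCommGroup X] [NormedSpace 𝕜 X]
    (L : (k : ℕ) → (Fin k → 𝕜) → (X →L[𝕜] 𝕜)) : (n : ℕ) → X → (Fin n → 𝕜)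
  | 0, _ => Fin.elim0
  | n + 1, f => Fin.snoc (α := fun _ => 𝕜) (infoMap L n f) (L n (infoMap L n f) f)

/-- The deterministic (possibly adaptive) algorithms `F → Y` that use `n` continuous linear
functionals: all maps `φ ∘ N_n` with an adaptive information mapping `N_n` and an arbitrary
reconstruction mapping `φ`. -/
def detAlgorithms (𝕜 : Type*) [RCLike 𝕜] {X : Type*} [NormedAddCommGroup X] [NormedSpace 𝕜 X]
    (F : Set X) (Y : Type*) (n : ℕ) : Set (F → Y) :=
  {A | ∃ (L : (k : ℕ) → (Fin k → 𝕜) → (X →L[𝕜] 𝕜)) (φ : (Fin n → 𝕜) → Y),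
    ∀ f : F, A f = φ (infoMap L n (f : X))}

/-- The topology on a convex set `F` induced by the semi-norm whose unit ball is `F - F`;
it is generated by the balls of this semi-norm. -/
@[reducible] def seminormTopology {X : Type*} [AddCommGroup X] [Module ℝ X] (F : Set X) :
    TopologicalSpace F :=
  TopologicalSpace.generateFrom
    {U | ∃ (g : F) (r : ℝ), 0 < r ∧
      U = {f : F | gauge {h : X | ∃ a ∈ F, ∃ b ∈ F, h = a - b} ((f : X) - (g : X)) < r}}

/-- The Borel `σ`-algebra `𝓑_F` of that topology. -/
@[reducible] def seminormBorel {X : Type*} [AddCommGroup X] [Module ℝ X] (F : Set X) :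
    MeasurableSpace F :=
  @borel F (seminormTopology F)

/-- `A = (A^ω)_ω` is a randomized adaptive algorithm for `S` on `F` using `n` functionals:
every realization is a deterministic adaptive algorithm using `n` functionals, and the error
`(f, ω) ↦ ‖S f - A^ω f‖` is jointly measurable. -/
def IsRandAlgorithm {𝕜 : Type*} [RCLike 𝕜]
    {X : Type*} [NormedAddCommGroup X] [NormedSpace 𝕜 X]
    [Module ℝ X] [IsScalarTower ℝ 𝕜 X]
    {Y : Type*} [NormedAddCommGroup Y] [NormedSpace 𝕜 Y]
    (S : X →L[𝕜] Y) (F : Set X) (n : ℕ)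
    {Ω : Type*} (mΩ : MeasurableSpace Ω) (A : Ω → F → Y) : Prop :=
  (∀ ω, A ω ∈ detAlgorithms 𝕜 F Y n) ∧
  @Measurable (F × Ω) ℝ (@Prod.instMeasurableSpace F Ω (seminormBorel F) mΩ) _
    (fun p : F × Ω => ‖S (p.1 : X) - A p.2 p.1‖)

/-- The worst-case error `sup_{f ∈ F} 𝔼 ‖S f - A f‖` of a randomized algorithm. -/
noncomputable def randError {𝕜 : Type*} [RCLike 𝕜]
    {X : Type*} [NormedAddCommGroup X] [NormedSpace 𝕜 X]
    {Y : Type*} [NormedAddCommGroup Y] [NormedSpace 𝕜 Y]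
    (S : X →L[𝕜] Y) (F : Set X)
    {Ω : Type*} [MeasurableSpace Ω] (P : Measure Ω) (A : Ω → F → Y) : ℝ≥0∞ :=
  ⨆ f : F, ∫⁻ ω, ‖S (f : X) - A ω f‖ₑ ∂P

/-- `e_n^ran(S, F)`: the `n`-th minimal worst-case error of randomized adaptive algorithms; the
infimum is over all algorithms over all probability spaces (in an arbitrary universe `v`). -/
noncomputable def eRan {𝕜 : Type u₁} [RCLike 𝕜]
    {X : Type u₂} [NormedAddCommGroup X] [NormedSpace 𝕜 X]
    [Module ℝ X] [IsScalarTower ℝ 𝕜 X]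
    {Y : Type u₃} [NormedAddCommGroup Y] [NormedSpace 𝕜 Y]
    (S : X →L[𝕜] Y) (F : Set X) (n : ℕ) : ℝ≥0∞ :=
  ⨅ (Ω : Type v) (mΩ : MeasurableSpace Ω) (P : Measure Ω) (_ : IsProbabilityMeasure P)
    (A : Ω → F → Y) (_ : IsRandAlgorithm S F n mΩ A), randError S F P A

/-- `g_n^lin(APP_∞, F)`: the linear sampling numbers of `F ⊆ B(D)`. -/
noncomputable def linSamplingNumber {𝕜 : Type*} [RCLike 𝕜] {D : Type*}
    (F : Set (BddFun 𝕜 D)) (n : ℕ) : ℝ≥0∞ :=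
  ⨅ (x : Fin n → D) (φ : Fin n → BddFun 𝕜 D),
    ⨆ f ∈ F, ‖f - ∑ i, f (x i) • φ i‖ₑ

/-- `F ⊆ B(D)` is the closed unit ball of a Hilbert space `H` (in the universe `w`) that is
continuously embedded into `B(D)`. -/
def IsHilbertUnitBall {𝕜 : Type u₁} [RCLike 𝕜] {D : Type u₂}
    (F : Set (BddFun 𝕜 D)) : Prop :=
  ∃ (H : Type w) (_ : NormedAddCommGroup H) (_ : InnerProductSpace 𝕜 H) (_ : CompleteSpace H)
    (J : H →L[𝕜] BddFun 𝕜 D), Function.Injective J ∧ F = J '' Metric.closedBall 0 1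

/-! Both parts squeeze the determinants of the matrices `(f i (x l))` of order `2n` with `f i ∈ F`.
Below: bordering by one more function and point multiplies the determinant by an interpolation
error, so if `g_{2n-1}` exceeds `C`, greedy choices make it at least `C^{2n}`
(`linSamplingNumber_le_of_det_le`). Above: the determinant is, up to normalization, the product of
the singular values `σ_j` of `R ∘ T`, where `T` maps a Euclidean unit ball into `F` and `R`
evaluates at the points, with norm at most `√(2n)`. Then `σ_{2k+1} ≤ σ_{2k} ≤ 3 √(2n) e_k^ran`
(`ofReal_singularValues_le_eRan`), and pairing the singular values gives the square of the product
of the `e_k^ran`.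

The bound on `σ_{2k}` is an average-case argument. `R ∘ T` expands by at least `σ_{2k}` on a
subspace of dimension `2k+1`. On its unit ball with the uniform distribution, `k` adaptive
measurements leave slices of at least about half the dimension on which the algorithm is constant,
and the symmetry `a ↦ -a` of each slice forces an average error of at least a third of the expansion
constant (`third_mul_volume_le_lintegral`). Fubini carries this to randomized algorithms.

For general `F`, normalizing `T` costs another `√(2n)`, so the constant is `3 · 2n = 6n`. For a
Hilbert ball, Hadamard's inequality makes the normalization free, and `3 √(2n) ≤ 6 √n`. -/

/-! ### Adaptive measurements as decision trees -/

/-- Functions on `E` computed with at most `k` adaptively chosen linear measurements with values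
in `V`, as decision trees. -/
def IsAdaptive (V : Type*) [AddCommGroup V] [Module ℝ V] {E Y : Type*} [AddCommGroup E]
    [Module ℝ E] : ℕ → (E → Y) → Prop
  | 0, A => ∃ c, ∀ a, A a = c
  | k + 1, A => ∃ (L : E →ₗ[ℝ] V) (B : V → E → Y),
      (∀ v, IsAdaptive V k (B v)) ∧ ∀ a, A a = B (L a) a

/-- On an affine slice the measurement of the base point is a known offset, which only relabels the
branches. -/
theorem IsAdaptive.comp_affine {V E K Y Z : Type*} [AddCommGroup V] [Module ℝ V]
    [AddCommGroup E] [Module ℝ E] [AddCommGroup K] [Module ℝ K] {k : ℕ} {A : E → Y}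
    (hA : IsAdaptive V k A) (z : E) (j : K →ₗ[ℝ] E) (g : Y → Z) :
    IsAdaptive V k (fun b => g (A (z + j b))) := by
  induction k generalizing A with
  | zero =>
    obtain ⟨c, hc⟩ := hA
    exact ⟨g c, fun b => by simp only [hc]⟩
  | succ k ih =>
    obtain ⟨L, B, hB, hA⟩ := hA
    refine ⟨L.comp j, fun v b => g (B (L z + v) (z + j b)), fun v => ih (hB _), fun b => ?_⟩
    simp [hA]

/-- `infoMap` appends the newest value, whereas a decision tree branches on the oldest; this peels
off the first measurement. -/
theorem infoMap_succ_eq_cons {𝕜 : Type*} [RCLike 𝕜] {X : Type*} [NormedAddCommGroup X]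
    [NormedSpace 𝕜 X] (L : (k : ℕ) → (Fin k → 𝕜) → (X →L[𝕜] 𝕜)) (n : ℕ) (f : X) :
    infoMap L (n + 1) f = Fin.cons (α := fun _ => 𝕜) (L 0 Fin.elim0 f)
      (infoMap (fun k y => L (k + 1) (Fin.cons (α := fun _ => 𝕜) (L 0 Fin.elim0 f) y)) n f) := by
  induction n with
  | zero =>
    funext i
    fin_cases i
    rfl
  | succ n ih =>
    rw [infoMap, ih, infoMap, Fin.cons_snoc_eq_snoc_cons]

theorem isAdaptive_infoMap {𝕜 : Type*} [RCLike 𝕜] {X E Y : Type*} [NormedAddCommGroup X]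
    [NormedSpace 𝕜 X] [Module ℝ X] [IsScalarTower ℝ 𝕜 X] [AddCommGroup E] [Module ℝ E]
    (T : E →ₗ[ℝ] X) (n : ℕ) (L : (k : ℕ) → (Fin k → 𝕜) → (X →L[𝕜] 𝕜)) (φ : (Fin n → 𝕜) → Y) :
    IsAdaptive 𝕜 n (fun a => φ (infoMap L n (T a))) := by
  induction n generalizing L with
  | zero => exact ⟨φ Fin.elim0, fun a => rfl⟩
  | succ n ih =>
    refine ⟨((L 0 Fin.elim0 : X →ₗ[𝕜] 𝕜).restrictScalars ℝ).comp T,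
      fun v a => φ (Fin.cons (α := fun _ => 𝕜) v
        (infoMap (fun k y => L (k + 1) (Fin.cons (α := fun _ => 𝕜) v y)) n (T a))),
      fun v => ih _ (fun y => φ (Fin.cons (α := fun _ => 𝕜) v y)), fun a => ?_⟩
    simp only [infoMap_succ_eq_cons]
    rfl

/-! ### Second moments and slicing of Euclidean balls -/

/-- The closed Euclidean ball of squared radius `ρ`. -/
def sqBall (E : Type*) [Norm E] (ρ : ℝ) : Set E := {a | ‖a‖ ^ 2 ≤ ρ}

theorem measurableSet_sqBall {E : Type*} [NormedAddCommGroup E] [MeasurableSpace E]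
    [BorelSpace E] (ρ : ℝ) : MeasurableSet (sqBall E ρ) :=
  measurableSet_le (by fun_prop) measurable_const

/-- The reflection exchanging `e` and `e'` preserves both volume and the ball. -/
theorem lintegral_sqBall_inner_eq {E : Type*} [NormedAddCommGroup E] [InnerProductSpace ℝ E]
    [FiniteDimensional ℝ E] [MeasurableSpace E] [BorelSpace E] {e e' : E} (h : ‖e‖ = ‖e'‖)
    (ρ : ℝ) :
    ∫⁻ a in sqBall E ρ, ENNReal.ofReal (inner ℝ e a ^ 2) =
      ∫⁻ a in sqBall E ρ, ENNReal.ofReal (inner ℝ e' a ^ 2) := by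
  set R := (ℝ ∙ (e - e'))ᗮ.reflection with hR
  have h1 : R e = e' := Submodule.reflection_sub h
  have := R.measurePreserving.setLIntegral_comp_emb
    R.toHomeomorph.measurableEmbedding (fun a => ENNReal.ofReal (inner ℝ e' a ^ 2)) (R ⁻¹' sqBall E ρ)
  rw [Set.image_preimage_eq _ R.surjective] at this
  rw [← this]
  have h2 : R ⁻¹' sqBall E ρ = sqBall E ρ := by
    ext a
    simp [sqBall]
  rw [h2]
  refine lintegral_congr fun a => ?_
  rw [← h1, R.inner_map_map]

theorem lintegral_sqBall_norm_sq {d : ℕ} (e : EuclideanSpace ℝ (Fin d)) (he : ‖e‖ = 1) (ρ : ℝ) :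
    ∫⁻ a in sqBall (EuclideanSpace ℝ (Fin d)) ρ, ENNReal.ofReal (‖a‖ ^ 2) =
      d * ∫⁻ a in sqBall (EuclideanSpace ℝ (Fin d)) ρ, ENNReal.ofReal (inner ℝ e a ^ 2) := by
  have h1 : ∀ a : EuclideanSpace ℝ (Fin d), ENNReal.ofReal (‖a‖ ^ 2) =
      ∑ i, ENNReal.ofReal (inner ℝ (EuclideanSpace.basisFun (Fin d) ℝ i) a ^ 2) := fun a => by
    rw [← ENNReal.ofReal_sum_of_nonneg fun i _ => sq_nonneg _]
    rw [← (EuclideanSpace.basisFun (Fin d) ℝ).sum_sq_norm_inner_right a]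
    simp
  simp_rw [h1]
  rw [lintegral_finsetSum _ fun i _ => by fun_prop]
  rw [Finset.sum_congr rfl fun i _ => lintegral_sqBall_inner_eq (e' := e)
    (by rw [he, (EuclideanSpace.basisFun (Fin d) ℝ).norm_eq_one]) ρ]
  simp

theorem lintegral_comp_prod {E U V : Type*}
    [NormedAddCommGroup E] [InnerProductSpace ℝ E] [FiniteDimensional ℝ E] [MeasurableSpace E]
    [BorelSpace E]
    [NormedAddCommGroup U] [InnerProductSpace ℝ U] [FiniteDimensional ℝ U] [MeasurableSpace U]
    [BorelSpace U]
    [NormedAddCommGroup V] [InnerProductSpace ℝ V] [FiniteDimensional ℝ V] [MeasurableSpace V]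
    [BorelSpace V] (e : WithLp 2 (U × V) ≃ₗᵢ[ℝ] E) {f : E → ℝ≥0∞} (hf : Measurable f) :
    ∫⁻ a, f a = ∫⁻ u, ∫⁻ v, f (e (WithLp.toLp 2 (u, v))) := by
  have h := e.measurePreserving.comp (WithLp.volume_preserving_toLp U V)
  rw [← h.lintegral_comp hf, Measure.volume_eq_prod,
    lintegral_prod (fun a => f ((e ∘ WithLp.toLp 2) a)) (hf.comp h.measurable).aemeasurable]
  rfl

theorem lintegral_sqBall_comp_prod {E U V : Type*}
    [NormedAddCommGroup E] [InnerProductSpace ℝ E] [FiniteDimensional ℝ E] [MeasurableSpace E]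
    [BorelSpace E]
    [NormedAddCommGroup U] [InnerProductSpace ℝ U] [FiniteDimensional ℝ U] [MeasurableSpace U]
    [BorelSpace U]
    [NormedAddCommGroup V] [InnerProductSpace ℝ V] [FiniteDimensional ℝ V] [MeasurableSpace V]
    [BorelSpace V] (e : WithLp 2 (U × V) ≃ₗᵢ[ℝ] E) {f : E → ℝ≥0∞} (hf : Measurable f) (ρ : ℝ) :
    ∫⁻ a in sqBall E ρ, f a =
      ∫⁻ u, ∫⁻ v in sqBall V (ρ - ‖u‖ ^ 2), f (e (WithLp.toLp 2 (u, v))) := by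
  rw [← lintegral_indicator (measurableSet_sqBall ρ),
    lintegral_comp_prod e (hf.indicator (measurableSet_sqBall ρ))]
  refine lintegral_congr fun u => ?_
  rw [← lintegral_indicator (measurableSet_sqBall _)]
  refine lintegral_congr fun v => ?_
  have : e (WithLp.toLp 2 (u, v)) ∈ sqBall E ρ ↔ v ∈ sqBall V (ρ - ‖u‖ ^ 2) := by
    simp only [sqBall, Set.mem_ofPred_eq, e.norm_map, WithLp.prod_norm_sq_eq_of_L2]
    exact le_sub_iff_add_le'.symm
  by_cases hv : v ∈ sqBall V (ρ - ‖u‖ ^ 2)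
  · rw [Set.indicator_of_mem (this.2 hv), Set.indicator_of_mem hv]
  · rw [Set.indicator_of_notMem (mt this.1 hv), Set.indicator_of_notMem hv]

/-- Rank-nullity in orthonormal coordinates of the kernel and its complement, so that an induction
over slices stays within the spaces `EuclideanSpace ℝ (Fin q)`. -/
theorem exists_kernel_splitting {V : Type*} [AddCommGroup V] [Module ℝ V] [FiniteDimensional ℝ V]
    {d : ℕ} (L : EuclideanSpace ℝ (Fin d) →ₗ[ℝ] V) :
    ∃ (p q : ℕ) (e : WithLp 2 (EuclideanSpace ℝ (Fin p) × EuclideanSpace ℝ (Fin q)) ≃ₗᵢ[ℝ]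
      EuclideanSpace ℝ (Fin d)), d ≤ q + Module.finrank ℝ V ∧
      ∀ v, L (e (WithLp.toLp 2 (0, v))) = 0 := by
  set K := LinearMap.ker L with hK
  let e₁ := LinearIsometryEquiv.withLpProdCongr (𝕜 := ℝ) 2 (stdOrthonormalBasis ℝ Kᗮ).repr
    (stdOrthonormalBasis ℝ Kᗮᗮ).repr
  refine ⟨_, _, e₁.symm.trans (Kᗮ.orthogonalDecomposition).symm, ?_, fun v => ?_⟩
  · rw [Submodule.orthogonal_orthogonal, hK]
    have h1 := LinearMap.finrank_range_add_finrank_ker L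
    have h2 := Submodule.finrank_le (LinearMap.range L)
    rw [finrank_euclideanSpace_fin] at h1
    omega
  · rw [← LinearMap.mem_ker, ← hK]
    set k := (stdOrthonormalBasis ℝ Kᗮᗮ).repr.symm v with hk
    have h1 : (e₁.symm.trans (Kᗮ.orthogonalDecomposition).symm) (WithLp.toLp 2 (0, v)) = k := by
      rw [LinearIsometryEquiv.trans_apply, LinearIsometryEquiv.symm_apply_eq,
        LinearIsometryEquiv.symm_apply_eq, Submodule.orthogonalDecomposition_apply]
      have h2 : Kᗮ.orthogonalProjectionOnto (k : EuclideanSpace ℝ (Fin d)) = 0 :=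
        Submodule.orthogonalProjectionOnto_eq_zero_iff.2 k.2
      rw [h2]
      simp [e₁, hk]
    rw [h1]
    exact K.orthogonal_orthogonal.le k.2

theorem lintegral_sqBall_neg {d : ℕ} {h : EuclideanSpace ℝ (Fin d) → ℝ≥0∞} (ρ : ℝ) :
    ∫⁻ a in sqBall (EuclideanSpace ℝ (Fin d)) ρ, h (-a) =
      ∫⁻ a in sqBall (EuclideanSpace ℝ (Fin d)) ρ, h a := by
  have h1 := (LinearIsometryEquiv.neg ℝ (E := EuclideanSpace ℝ (Fin d))).measurePreserving
  have := h1.setLIntegral_comp_emb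
    (LinearIsometryEquiv.neg ℝ (E := EuclideanSpace ℝ (Fin d))).toHomeomorph.measurableEmbedding h
      (sqBall (EuclideanSpace ℝ (Fin d)) ρ)
  rw [LinearIsometryEquiv.coe_neg] at this
  refine this.trans ?_
  congr 2
  ext a
  simp [sqBall]

/-! ### Average error over the unit ball -/

/-- Pairing `a` with `-a` cancels `c` and leaves `2 ‖S a‖`. The weaker weight `‖a‖ ^ 2 ≤ ‖a‖` is
used because second moments split exactly over directions. The measurable majorant `h` avoids any
measurability assumption on the approximation. -/
theorem lintegral_constant_approximation_ge {d : ℕ} {Y : Type*} [NormedAddCommGroup Y]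
    [NormedSpace ℝ Y] (S : EuclideanSpace ℝ (Fin d) →ₗ[ℝ] Y) (c : Y) {σ ρ : ℝ}
    (hS : ∀ a, σ * ‖a‖ ≤ ‖S a‖) (hρ : ρ ≤ 1) (hσ : 0 ≤ σ)
    {h : EuclideanSpace ℝ (Fin d) → ℝ≥0∞} (hm : Measurable h)
    (hh : ∀ a, ‖a‖ ^ 2 ≤ ρ → ‖S a - c‖ₑ ≤ h a) :
    ENNReal.ofReal σ * ∫⁻ a in sqBall (EuclideanSpace ℝ (Fin d)) ρ, ENNReal.ofReal (‖a‖ ^ 2) ≤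
      ∫⁻ a in sqBall (EuclideanSpace ℝ (Fin d)) ρ, h a := by
  have key : 2 * (ENNReal.ofReal σ *
      ∫⁻ a in sqBall (EuclideanSpace ℝ (Fin d)) ρ, ENNReal.ofReal (‖a‖ ^ 2)) ≤
      2 * ∫⁻ a in sqBall (EuclideanSpace ℝ (Fin d)) ρ, h a := by
    calc _ = ∫⁻ a in sqBall (EuclideanSpace ℝ (Fin d)) ρ,
        2 * (ENNReal.ofReal σ * ENNReal.ofReal (‖a‖ ^ 2)) := by
          rw [lintegral_const_mul _ (by fun_prop), lintegral_const_mul _ (by fun_prop)]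
      _ ≤ ∫⁻ a in sqBall (EuclideanSpace ℝ (Fin d)) ρ, (h a + h (-a)) := by
          refine setLIntegral_mono (by fun_prop) fun a ha => ?_
          have h1 : ‖a‖ ≤ 1 := by
            have : ‖a‖ ^ 2 ≤ 1 := le_trans ha hρ
            nlinarith [norm_nonneg a]
          have h2 : σ * ‖a‖ ^ 2 ≤ ‖S a‖ := le_trans
            (mul_le_mul_of_nonneg_left (by nlinarith [norm_nonneg a]) hσ) (hS a)
          calc 2 * (ENNReal.ofReal σ * ENNReal.ofReal (‖a‖ ^ 2))
              = ENNReal.ofReal (2 * (σ * ‖a‖ ^ 2)) := by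
                rw [ENNReal.ofReal_mul (by norm_num), ENNReal.ofReal_mul hσ, ENNReal.ofReal_ofNat]
            _ ≤ ENNReal.ofReal ‖(S a - c) - (S (-a) - c)‖ := by
                refine ENNReal.ofReal_le_ofReal ?_
                have : (S a - c) - (S (-a) - c) = (2 : ℝ) • S a := by
                  rw [map_neg, two_smul]; abel
                rw [this, norm_smul]
                simpa using h2
            _ ≤ ‖S a - c‖ₑ + ‖S (-a) - c‖ₑ := by
                rw [ofReal_norm]
                exact enorm_sub_le
            _ ≤ h a + h (-a) := add_le_add (hh a ha) (hh (-a) (by rw [norm_neg]; exact ha))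
      _ = _ := by
          rw [lintegral_add_left hm, lintegral_sqBall_neg, two_mul]
  rwa [ENNReal.mul_le_mul_iff_right (by norm_num) (by norm_num)] at key

/-- Average error of adaptive approximations over Euclidean balls. -/
theorem lintegral_adaptive_approximation_ge {V Y : Type*} [AddCommGroup V] [Module ℝ V]
    [FiniteDimensional ℝ V] [NormedAddCommGroup Y] [NormedSpace ℝ Y] {σ : ℝ} (hσ : 0 ≤ σ) (k : ℕ) :
    ∀ (d : ℕ) (S : EuclideanSpace ℝ (Fin d) →ₗ[ℝ] Y) (A : EuclideanSpace ℝ (Fin d) → Y)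
      (_ : IsAdaptive V k A) (_ : ∀ a, σ * ‖a‖ ≤ ‖S a‖) (ρ : ℝ) (_ : ρ ≤ 1)
      (h : EuclideanSpace ℝ (Fin d) → ℝ≥0∞) (_ : Measurable h)
      (_ : ∀ a, ‖a‖ ^ 2 ≤ ρ → ‖S a - A a‖ₑ ≤ h a)
      (e : EuclideanSpace ℝ (Fin d)) (_ : ‖e‖ = 1),
      ENNReal.ofReal (σ * (d - Module.finrank ℝ V * k)) *
        ∫⁻ a in sqBall (EuclideanSpace ℝ (Fin d)) ρ, ENNReal.ofReal (inner ℝ e a ^ 2) ≤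
      ∫⁻ a in sqBall (EuclideanSpace ℝ (Fin d)) ρ, h a := by
  induction k with
  | zero =>
    intro d S A ⟨c, hA⟩ hS ρ hρ h hm hh e he
    simp only [hA] at hh
    refine le_trans (le_of_eq ?_) (lintegral_constant_approximation_ge S c hS hρ hσ hm hh)
    rw [lintegral_sqBall_norm_sq e he, ← mul_assoc, ENNReal.ofReal_mul hσ]
    simp
  | succ k ih =>
    intro d S A ⟨L, B, hB, hA⟩ hS ρ hρ h hm hh e he
    obtain ⟨p, q, E, hdim, hE⟩ := exists_kernel_splitting L
    have hdim' : (d : ℝ) ≤ q + Module.finrank ℝ V := by exact_mod_cast hdim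
    have hcoef : σ * (d - Module.finrank ℝ V * ((k + 1 : ℕ) : ℝ)) ≤
        σ * (q - Module.finrank ℝ V * k) := by
      refine mul_le_mul_of_nonneg_left ?_ hσ
      push_cast
      linarith
    rcases Nat.eq_zero_or_pos q with hq | hq
    · rw [ENNReal.ofReal_of_nonpos, zero_mul]
      · exact zero_le
      · refine hcoef.trans (mul_nonpos_of_nonneg_of_nonpos hσ ?_)
        rw [hq, Nat.cast_zero, zero_sub, neg_nonpos]
        positivity
    set e' : EuclideanSpace ℝ (Fin q) := EuclideanSpace.basisFun (Fin q) ℝ ⟨0, hq⟩ with he'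
    have hn' : ‖e'‖ = 1 := (EuclideanSpace.basisFun (Fin q) ℝ).norm_eq_one _
    -- The moment does not depend on the direction, so `e` may be moved into the kernel of `L`;
    -- there it is a moment of the slice variable alone.
    rw [lintegral_sqBall_inner_eq (e' := E (WithLp.toLp 2 (0, e')))
      (by rw [he, E.norm_map, WithLp.norm_toLp_snd, hn']),
      lintegral_sqBall_comp_prod E (by fun_prop), lintegral_sqBall_comp_prod E hm,
      ← lintegral_const_mul' _ _ ENNReal.ofReal_ne_top]
    refine lintegral_mono fun u => ?_
    have hsplit : ∀ v, E (WithLp.toLp 2 (u, v)) =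
        E (WithLp.toLp 2 (u, 0)) + E (WithLp.toLp 2 (0, v)) := fun v => by
      rw [← map_add]
      congr 1
      rw [← WithLp.toLp_add, Prod.mk_add_mk, add_zero, zero_add]
    let j : EuclideanSpace ℝ (Fin q) →ₗ[ℝ] EuclideanSpace ℝ (Fin d) :=
      E.toLinearEquiv.toLinearMap ∘ₗ (WithLp.linearEquiv 2 ℝ _).symm.toLinearMap ∘ₗ
        LinearMap.inr ℝ _ _
    have hj : ∀ v, j v = E (WithLp.toLp 2 (0, v)) := fun v => rfl
    -- On the slice over `u` the first measurement is constant. One branch with `k` measurements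
    -- remains, and the fixed vector `S (E (u, 0))` is moved into the approximation.
    refine le_trans ?_ (ih q (S ∘ₗ j) _ ((hB (L (E (WithLp.toLp 2 (u, 0))))).comp_affine
      (E (WithLp.toLp 2 (u, 0))) j (fun y => y - S (E (WithLp.toLp 2 (u, 0)))))
      (fun v => ?_) (ρ - ‖u‖ ^ 2) (by nlinarith [sq_nonneg ‖u‖])
      (fun v => h (E (WithLp.toLp 2 (u, v)))) (by fun_prop) (fun v hv => ?_) e' hn')
    · refine mul_le_mul' (ENNReal.ofReal_le_ofReal hcoef) (le_of_eq ?_)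
      refine lintegral_congr fun v => ?_
      rw [E.inner_map_map]
      simp [WithLp.prod_inner_apply]
    · refine le_trans (le_of_eq ?_) (hS (j v))
      rw [hj, E.norm_map, WithLp.norm_toLp_snd]
    · have h1 := hh (E (WithLp.toLp 2 (u, v))) (by
        rw [E.norm_map, WithLp.prod_norm_sq_eq_of_L2]
        exact le_sub_iff_add_le'.1 hv)
      refine le_trans (le_of_eq ?_) h1
      have h2 : L (E (WithLp.toLp 2 (u, v))) = L (E (WithLp.toLp 2 (u, 0))) := by
        rw [hsplit, map_add, hE, add_zero]
      rw [hA, h2, LinearMap.comp_apply, hj, hsplit v, map_add]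
      congr 1
      abel

/-- Polar coordinates: the radial integral of `y ^ (d + 1)` over `[0, 1]` is `1 / (d + 2)`. -/
theorem lintegral_sqBall_one_norm_sq {d : ℕ} (hd : 0 < d) :
    (d + 2) * ∫⁻ a in sqBall (EuclideanSpace ℝ (Fin d)) 1, ENNReal.ofReal (‖a‖ ^ 2) =
      d * volume (sqBall (EuclideanSpace ℝ (Fin d)) 1) := by
  have : Nonempty (Fin d) := ⟨⟨0, hd⟩⟩
  have hball : sqBall (EuclideanSpace ℝ (Fin d)) 1 = Metric.closedBall 0 1 := by
    ext a
    simp [sqBall]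
  have hvol : volume (Metric.closedBall (0 : EuclideanSpace ℝ (Fin d)) 1) =
      volume (Metric.ball (0 : EuclideanSpace ℝ (Fin d)) 1) :=
    Measure.addHaar_closedBall_eq_addHaar_ball _ _ _
  have hrad := integral_fun_norm_addHaar (volume : Measure (EuclideanSpace ℝ (Fin d)))
    ((Set.Iic (1 : ℝ)).indicator (fun y => y ^ 2))
  have h1 : ∫ y in Set.Ioi (0 : ℝ),
      y ^ (Module.finrank ℝ (EuclideanSpace ℝ (Fin d)) - 1) •
        (Set.Iic (1 : ℝ)).indicator (fun y => y ^ 2) y = 1 / (d + 2) := by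
    have h2 : ∀ y : ℝ, y ^ (d - 1) • (Set.Iic (1 : ℝ)).indicator (fun y => y ^ 2) y =
        (Set.Iic (1 : ℝ)).indicator (fun y => y ^ (d + 1)) y := fun y => by
      by_cases hy : y ∈ Set.Iic (1 : ℝ)
      · rw [Set.indicator_of_mem hy, Set.indicator_of_mem hy, smul_eq_mul, ← pow_add]
        congr 1
        omega
      · rw [Set.indicator_of_notMem hy, Set.indicator_of_notMem hy, smul_zero]
    rw [finrank_euclideanSpace_fin]
    simp_rw [h2]
    rw [setIntegral_indicator measurableSet_Iic, Set.Ioi_inter_Iic,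
      ← intervalIntegral.integral_of_le zero_le_one, integral_pow]
    push_cast
    rw [one_pow, zero_pow (by omega), sub_zero, add_assoc, one_add_one_eq_two]
  have h3 : ∀ a : EuclideanSpace ℝ (Fin d), (Set.Iic (1 : ℝ)).indicator (fun y => y ^ 2) ‖a‖ =
      (Metric.closedBall (0 : EuclideanSpace ℝ (Fin d)) 1).indicator (fun a => ‖a‖ ^ 2) a := by
    intro a
    by_cases ha : ‖a‖ ≤ 1
    · rw [Set.indicator_of_mem (by exact ha), Set.indicator_of_mem (by simpa using ha)]
    · rw [Set.indicator_of_notMem (by exact ha), Set.indicator_of_notMem (by simpa using ha)]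
  simp_rw [h1, h3] at hrad
  rw [integral_indicator Metric.isClosed_closedBall.measurableSet, finrank_euclideanSpace_fin]
    at hrad
  have hint : IntegrableOn (fun a : EuclideanSpace ℝ (Fin d) => ‖a‖ ^ 2)
      (Metric.closedBall 0 1) :=
    ContinuousOn.integrableOn_compact (isCompact_closedBall _ _) (by fun_prop)
  rw [hball, ← ofReal_integral_eq_lintegral_ofReal hint (ae_of_all _ fun a => sq_nonneg _), hrad,
    hvol, nsmul_eq_mul, smul_eq_mul, ENNReal.ofReal_mul (by positivity),
    ENNReal.ofReal_mul (by positivity), measureReal_def,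
    ENNReal.ofReal_toReal measure_ball_lt_top.ne, ENNReal.ofReal_natCast, mul_left_comm]
  congr 1
  rw [mul_left_comm, one_div, ENNReal.ofReal_inv_of_pos (by positivity),
    show (d : ℝ) + 2 = ((d + 2 : ℕ) : ℝ) by push_cast; ring, ENNReal.ofReal_natCast]
  push_cast
  rw [ENNReal.mul_inv_cancel (by simp) (by finiteness), mul_one]

/-- Real dimension `β (2 k + 1)` and `k` measurements of real dimension `β`: the average error over
the unit ball is at least `σ / 3`. -/
theorem third_mul_volume_le_lintegral {V Y : Type*} [AddCommGroup V] [Module ℝ V]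
    [FiniteDimensional ℝ V] [Nontrivial V] [NormedAddCommGroup Y] [NormedSpace ℝ Y] {σ : ℝ}
    (hσ : 0 ≤ σ) {k d : ℕ} (hd : d = Module.finrank ℝ V * (2 * k + 1))
    (S : EuclideanSpace ℝ (Fin d) →ₗ[ℝ] Y) {A : EuclideanSpace ℝ (Fin d) → Y}
    (hA : IsAdaptive V k A) (hS : ∀ a, σ * ‖a‖ ≤ ‖S a‖)
    {h : EuclideanSpace ℝ (Fin d) → ℝ≥0∞} (hm : Measurable h)
    (hh : ∀ a, ‖a‖ ^ 2 ≤ 1 → ‖S a - A a‖ₑ ≤ h a) :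
    ENNReal.ofReal (σ / 3) * volume (sqBall (EuclideanSpace ℝ (Fin d)) 1) ≤
      ∫⁻ a in sqBall (EuclideanSpace ℝ (Fin d)) 1, h a := by
  have hβ : 0 < Module.finrank ℝ V := Module.finrank_pos
  have hd0 : 0 < d := hd ▸ Nat.mul_pos hβ (by omega)
  set e : EuclideanSpace ℝ (Fin d) := EuclideanSpace.basisFun (Fin d) ℝ ⟨0, hd0⟩ with he
  have hn : ‖e‖ = 1 := (EuclideanSpace.basisFun (Fin d) ℝ).norm_eq_one _
  refine le_trans ?_ (lintegral_adaptive_approximation_ge hσ k d S A hA hS 1 le_rfl h hm hh e hn)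
  have h1 := lintegral_sqBall_one_norm_sq hd0
  rw [lintegral_sqBall_norm_sq e hn, mul_left_comm,
    ENNReal.mul_right_inj (by simpa using hd0.ne') (by simp)] at h1
  rw [← h1, ← mul_assoc]
  refine mul_le_mul' ?_ le_rfl
  rw [show (d : ℝ≥0∞) + 2 = ENNReal.ofReal ((d : ℝ) + 2) by
    rw [ENNReal.ofReal_add (by positivity) (by norm_num), ENNReal.ofReal_natCast,
      ENNReal.ofReal_ofNat], ← ENNReal.ofReal_mul (by positivity)]
  refine ENNReal.ofReal_le_ofReal ?_
  have hdr : (d : ℝ) = Module.finrank ℝ V * (2 * k + 1) := by exact_mod_cast hd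
  have hβr : (1 : ℝ) ≤ Module.finrank ℝ V := by exact_mod_cast hβ
  rw [div_mul_eq_mul_div, div_le_iff₀ (by norm_num), mul_assoc]
  refine mul_le_mul_of_nonneg_left ?_ hσ
  rw [hdr]
  -- With `β` the real dimension of `V`, the claim `d + 2 ≤ 3 (d - β k)` reads `2 ≤ β (k + 2)`.
  nlinarith [mul_nonneg (sub_nonneg.2 hβr) (Nat.cast_nonneg (α := ℝ) k)]

/-! ### Measurable parametrization of `F` -/

/-- The radial retraction onto the unit ball. -/
noncomputable def radialRetract {E : Type*} [NormedAddCommGroup E] [NormedSpace ℝ E] (a : E) : E :=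
  (max 1 ‖a‖)⁻¹ • a

theorem continuous_radialRetract {E : Type*} [NormedAddCommGroup E] [NormedSpace ℝ E] :
    Continuous (radialRetract : E → E) := by
  unfold radialRetract
  exact ((continuous_const.max continuous_norm).inv₀ fun a =>
    (lt_max_of_lt_left one_pos).ne').smul continuous_id

theorem norm_radialRetract_le {E : Type*} [NormedAddCommGroup E] [NormedSpace ℝ E] (a : E) :
    ‖radialRetract a‖ ≤ 1 := by
  have h : (0 : ℝ) < max 1 ‖a‖ := lt_max_of_lt_left one_pos
  rw [radialRetract, norm_smul, norm_inv, Real.norm_of_nonneg h.le, inv_mul_le_iff₀ h, mul_one]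
  exact le_max_right _ _

theorem radialRetract_of_norm_le {E : Type*} [NormedAddCommGroup E] [NormedSpace ℝ E] {a : E}
    (ha : ‖a‖ ≤ 1) : radialRetract a = a := by
  rw [radialRetract, max_eq_left ha, inv_one, one_smul]

theorem gauge_comp_linearMap {E X : Type*} [AddCommGroup E] [Module ℝ E] [AddCommGroup X]
    [Module ℝ X] (T : E →ₗ[ℝ] X) (s : Set X) (x : E) : gauge s (T x) = gauge (T ⁻¹' s) x := by
  simp only [gauge_def', Set.mem_preimage, map_smul]

open scoped Pointwise in
-- The affine map `a ↦ T a - g` is the slice `t = 1` of the linear map `(a, t) ↦ T a - t • g`. The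
-- latter sends the unit ball into `F - F`, so the pulled-back gauge is continuous.
theorem continuous_gauge_sub {E X : Type*} [NormedAddCommGroup E] [NormedSpace ℝ E]
    [AddCommGroup X] [Module ℝ X] {F : Set X} (hF : Convex ℝ F) (hneg : ∀ f ∈ F, -f ∈ F)
    (T : E →ₗ[ℝ] X) (hT : ∀ a, ‖a‖ ≤ 1 → T a ∈ F) {g : X} (hg : g ∈ F) :
    Continuous fun a => gauge {h : X | ∃ a ∈ F, ∃ b ∈ F, h = a - b} (T a - g) := by
  set s : Set X := {h : X | ∃ a ∈ F, ∃ b ∈ F, h = a - b} with hs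
  have hsF : s = F - F := by
    ext h
    simp only [hs, Set.mem_sub, Set.mem_ofPred_eq]
    constructor
    · rintro ⟨a, ha, b, hb, rfl⟩
      exact ⟨a, ha, b, hb, rfl⟩
    · rintro ⟨a, ha, b, hb, rfl⟩
      exact ⟨a, ha, b, hb, rfl⟩
  let T' : E × ℝ →ₗ[ℝ] X := T ∘ₗ LinearMap.fst ℝ E ℝ -
    (LinearMap.toSpanSingleton ℝ X g) ∘ₗ LinearMap.snd ℝ E ℝ
  have hT' : ∀ a t, T' (a, t) = T a - t • g := fun a t => rfl
  have hconv : Convex ℝ (T' ⁻¹' s) := (hsF ▸ hF.sub hF : Convex ℝ s).linear_preimage T'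
  have hnhds : T' ⁻¹' s ∈ nhds (0 : E × ℝ) := by
    refine Filter.mem_of_superset (Metric.closedBall_mem_nhds 0 one_pos) ?_
    rintro ⟨a, t⟩ hat
    rw [mem_closedBall_zero_iff, Prod.norm_def, max_le_iff] at hat
    refine ⟨T a, hT a hat.1, t • g, ?_, hT' a t⟩
    have ht : |t| ≤ 1 := hat.2
    have h1 : t • g = ((1 + t) / 2) • g + ((1 - t) / 2) • (-g) := by
      rw [smul_neg, ← sub_eq_add_neg, ← sub_smul]
      congr 1
      ring
    rw [h1]
    exact hF hg (hneg g hg) (by linarith [neg_le_of_abs_le ht]) (by linarith [le_of_abs_le ht])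
      (by ring)
  have := (continuous_gauge hconv hnhds).comp (f := fun a : E => (a, (1 : ℝ))) (by fun_prop)
  convert this using 2 with a
  rw [Function.comp_apply, ← gauge_comp_linearMap, hT', one_smul]

/-- The retraction turns `T` into a map from the whole space to `F`, unchanged on the unit ball,
along which joint measurability of the error can be pulled back. -/
theorem measurable_radialRetract_seminormBorel {E X : Type*} [NormedAddCommGroup E]
    [NormedSpace ℝ E] [MeasurableSpace E] [BorelSpace E]
    [AddCommGroup X] [Module ℝ X] {F : Set X} (hF : Convex ℝ F) (hneg : ∀ f ∈ F, -f ∈ F)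
    (T : E →ₗ[ℝ] X) (hT : ∀ a, ‖a‖ ≤ 1 → T a ∈ F) :
    @Measurable E F _ (seminormBorel F)
      (fun a => ⟨T (radialRetract a), hT _ (norm_radialRetract_le a)⟩) := by
  let _ := seminormTopology F
  have hc : Continuous (fun a : E =>
      (⟨T (radialRetract a), hT _ (norm_radialRetract_le a)⟩ : F)) := by
    refine continuous_generateFrom_iff.2 ?_
    rintro U ⟨g, r, -, rfl⟩
    exact isOpen_lt (((continuous_gauge_sub hF hneg T hT g.2)).comp continuous_radialRetract)
      continuous_const
  rw [BorelSpace.measurable_eq (α := E)]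
  exact hc.borel_measurable

/-! ### From average error to randomized error -/

/-- The worst expected error dominates its average over the ball; after exchanging the integrals,
each realization is a deterministic adaptive algorithm. -/
theorem ofReal_div_three_le_randError {𝕜 : Type*} [RCLike 𝕜]
    {X : Type*} [NormedAddCommGroup X] [NormedSpace 𝕜 X] [Module ℝ X] [IsScalarTower ℝ 𝕜 X]
    {Y : Type*} [NormedAddCommGroup Y] [NormedSpace 𝕜 Y] [NormedSpace ℝ Y] [IsScalarTower ℝ 𝕜 Y]
    (S : X →L[𝕜] Y) {F : Set X} (hF : Convex ℝ F) (hneg : ∀ f ∈ F, -f ∈ F)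
    {k d : ℕ} (hd : d = Module.finrank ℝ 𝕜 * (2 * k + 1))
    (T : EuclideanSpace ℝ (Fin d) →ₗ[ℝ] X) (hT : ∀ a, ‖a‖ ≤ 1 → T a ∈ F) {σ : ℝ} (hσ : 0 ≤ σ)
    (hST : ∀ a, σ * ‖a‖ ≤ ‖S (T a)‖) {Ω : Type*} {mΩ : MeasurableSpace Ω} (P : Measure Ω)
    [IsProbabilityMeasure P] {A : Ω → F → Y} (hA : IsRandAlgorithm S F k mΩ A) :
    ENNReal.ofReal (σ / 3) ≤ randError S F P A := by
  set B := sqBall (EuclideanSpace ℝ (Fin d)) 1 with hB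
  obtain ⟨ψ, hψ, hψT⟩ : ∃ ψ : EuclideanSpace ℝ (Fin d) → F,
      @Measurable _ F _ (seminormBorel F) ψ ∧ ∀ a, (ψ a : X) = T (radialRetract a) :=
    ⟨_, measurable_radialRetract_seminormBorel hF hneg T hT, fun a => rfl⟩
  have hjoint : Measurable (fun p : EuclideanSpace ℝ (Fin d) × Ω =>
      ‖S (ψ p.1 : X) - A p.2 (ψ p.1)‖ₑ) := by
    let _ := seminormBorel F
    have h1 : Measurable (fun p : EuclideanSpace ℝ (Fin d) × Ω => (ψ p.1, p.2)) :=
      (hψ.comp measurable_fst).prodMk measurable_snd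
    have h2 := (hA.2.comp h1).ennreal_ofReal
    simpa only [Function.comp_def, ofReal_norm] using h2
  have hdet : ∀ ω, ENNReal.ofReal (σ / 3) * volume B ≤
      ∫⁻ a in B, ‖S (ψ a : X) - A ω (ψ a)‖ₑ := by
    intro ω
    obtain ⟨L, φ, hLφ⟩ := hA.1 ω
    have hm : Measurable fun a => ‖S (ψ a : X) - A ω (ψ a)‖ₑ := 
      hjoint.comp (measurable_id.prodMk measurable_const)
    refine third_mul_volume_le_lintegral (V := 𝕜) hσ hd
      ((S.toLinearMap.restrictScalars ℝ).comp T) (isAdaptive_infoMap T k L φ) hST hm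
      fun a ha => ?_
    have hr : radialRetract a = a := radialRetract_of_norm_le (by nlinarith [norm_nonneg a])
    rw [hLφ, hψT, hr]
    rfl
  have hvol0 : volume B ≠ 0 := by
    refine (Metric.measure_closedBall_pos volume (0 : EuclideanSpace ℝ (Fin d)) one_pos).ne' ∘ ?_
    rw [hB]
    intro h
    convert h using 2
    ext a
    simp [sqBall]
  have hvolt : volume B ≠ ∞ := by
    have : B = Metric.closedBall 0 1 := by
      ext a
      simp [hB, sqBall]
    rw [this]
    exact measure_closedBall_lt_top.ne
  rw [← ENNReal.mul_le_mul_iff_left hvol0 hvolt]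
  calc ENNReal.ofReal (σ / 3) * volume B = ∫⁻ _, ENNReal.ofReal (σ / 3) * volume B ∂P := by simp
    _ ≤ ∫⁻ ω, (∫⁻ a in B, ‖S (ψ a : X) - A ω (ψ a)‖ₑ) ∂P := lintegral_mono hdet
    _ = ∫⁻ a in B, (∫⁻ ω, ‖S (ψ a : X) - A ω (ψ a)‖ₑ ∂P) :=
        lintegral_lintegral_swap (f := fun ω a => ‖S (ψ a : X) - A ω (ψ a)‖ₑ)
          (hjoint.comp measurable_swap).aemeasurable
    _ ≤ ∫⁻ _ in B, randError S F P A :=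
        lintegral_mono fun a => le_iSup (fun f : F => ∫⁻ ω, ‖S (f : X) - A ω f‖ₑ ∂P) (ψ a)
    _ = randError S F P A * volume B := by simp

theorem ofReal_div_three_le_eRan {𝕜 : Type u₁} [RCLike 𝕜]
    {X : Type u₂} [NormedAddCommGroup X] [NormedSpace 𝕜 X] [Module ℝ X] [IsScalarTower ℝ 𝕜 X]
    {Y : Type u₃} [NormedAddCommGroup Y] [NormedSpace 𝕜 Y] [NormedSpace ℝ Y] [IsScalarTower ℝ 𝕜 Y]
    (S : X →L[𝕜] Y) {F : Set X} (hF : Convex ℝ F) (hneg : ∀ f ∈ F, -f ∈ F)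
    {W : Type*} [NormedAddCommGroup W] [InnerProductSpace 𝕜 W] [FiniteDimensional 𝕜 W]
    {k : ℕ} (hW : Module.finrank 𝕜 W = 2 * k + 1) (T : W →ₗ[𝕜] X) (hT : ∀ a, ‖a‖ ≤ 1 → T a ∈ F)
    {σ : ℝ} (hσ : 0 ≤ σ) (hST : ∀ a, σ * ‖a‖ ≤ ‖S (T a)‖) :
    ENNReal.ofReal (σ / 3) ≤ eRan.{u₁, u₂, u₃, v} S F k := by
  refine le_iInf fun Ω => le_iInf fun mΩ => le_iInf fun P => le_iInf fun hP => le_iInf fun A =>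
    le_iInf fun hA => ?_
  let _ : InnerProductSpace ℝ W := InnerProductSpace.rclikeToReal 𝕜 W
  have : IsScalarTower ℝ 𝕜 W := ⟨fun r c x => by
    change (r • c) • x = ((r : 𝕜)) • c • x
    rw [smul_smul, RCLike.real_smul_eq_coe_mul]⟩
  have : FiniteDimensional ℝ W := FiniteDimensional.trans ℝ 𝕜 W
  let e := (stdOrthonormalBasis ℝ W).repr.symm
  have hd : Module.finrank ℝ W = Module.finrank ℝ 𝕜 * (2 * k + 1) := by
    rw [← Module.finrank_mul_finrank ℝ 𝕜 W, hW]
  exact ofReal_div_three_le_randError S hF hneg hd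
    ((T.restrictScalars ℝ) ∘ₗ e.toLinearEquiv.toLinearMap)
    (fun a ha => hT _ (by rwa [← e.norm_map] at ha)) hσ
    (fun a => by rw [← e.norm_map]; exact hST _) P hA

/-! ### Singular values against randomized errors -/

/-- Take the span of the eigenvectors of `M* M` for the `j + 1` largest eigenvalues. -/
theorem LinearMap.exists_submodule_singularValues_mul_norm_le {𝕜 U Z : Type*} [RCLike 𝕜]
    [NormedAddCommGroup U] [InnerProductSpace 𝕜 U] [FiniteDimensional 𝕜 U]
    [NormedAddCommGroup Z] [InnerProductSpace 𝕜 Z] [FiniteDimensional 𝕜 Z]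
    (M : U →ₗ[𝕜] Z) {j : ℕ} (hj : j < Module.finrank 𝕜 U) :
    ∃ W : Submodule 𝕜 U, Module.finrank 𝕜 W = j + 1 ∧
      ∀ a ∈ W, M.singularValues j * ‖a‖ ≤ ‖M a‖ := by
  have hT := M.isSymmetric_adjoint_comp_self
  set b := hT.eigenvectorBasis rfl with hb
  have hli : LinearIndependent 𝕜 (b ∘ Fin.castLE hj) :=
    b.orthonormal.linearIndependent.comp _ (Fin.castLE_injective hj)
  refine ⟨Submodule.span 𝕜 (Set.range (b ∘ Fin.castLE hj)), ?_, fun a ha => ?_⟩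
  · rw [finrank_span_eq_card hli, Fintype.card_fin]
  have hvanish : ∀ i : Fin (Module.finrank 𝕜 U), j < i → inner 𝕜 (b i) a = 0 := by
    intro i hi
    have : a ∈ (𝕜 ∙ b i)ᗮ := by
      refine Submodule.span_le.2 ?_ ha
      rintro _ ⟨l, rfl⟩
      rw [SetLike.mem_coe, Submodule.mem_orthogonal_singleton_iff_inner_right]
      refine b.inner_eq_zero fun h => ?_
      have := congrArg Fin.val h
      simp only [Fin.val_castLE] at this
      omega
    exact Submodule.mem_orthogonal_singleton_iff_inner_right.1 this
  have hsq : ‖M a‖ ^ 2 = ∑ i : Fin (Module.finrank 𝕜 U),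
      M.singularValues i ^ 2 * ‖inner 𝕜 (b i) a‖ ^ 2 := by
    have h1 : ((‖M a‖ ^ 2 : ℝ) : 𝕜) = inner 𝕜 a ((LinearMap.adjoint M ∘ₗ M) a) := by
      rw [LinearMap.comp_apply, LinearMap.adjoint_inner_right, inner_self_eq_norm_sq_to_K]
      push_cast
      rfl
    have h2 : inner 𝕜 a ((LinearMap.adjoint M ∘ₗ M) a) = ((∑ i : Fin (Module.finrank 𝕜 U),
      M.singularValues i ^ 2 * ‖inner 𝕜 (b i) a‖ ^ 2 : ℝ) : 𝕜) := by
      rw [← b.sum_inner_mul_inner]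
      push_cast
      refine Finset.sum_congr rfl fun i _ => ?_
      rw [← LinearMap.coe_comp, ← hT (b i) a, hT.apply_eigenvectorBasis, inner_smul_left, ← M.sq_singularValues_fin rfl,
        RCLike.conj_ofReal, mul_left_comm, ← inner_conj_symm a (b i), RCLike.conj_mul]
      push_cast
      rfl
    exact RCLike.ofReal_injective (h1.trans h2)
  refine le_of_sq_le_sq ?_ (norm_nonneg _)
  rw [hsq, mul_pow, ← b.sum_sq_norm_inner_right a, Finset.mul_sum]
  refine Finset.sum_le_sum fun i _ => ?_
  rcases lt_or_ge j i with hi | hi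
  · rw [hvanish i hi]
    simp
  · have := M.singularValues_antitone hi
    have h0 := M.singularValues_nonneg j
    gcongr

theorem Finset.prod_range_two_mul {M : Type*} [CommMonoid M] (f : ℕ → M) (n : ℕ) :
    ∏ i ∈ Finset.range (2 * n), f i = ∏ k ∈ Finset.range n, f (2 * k) * f (2 * k + 1) := by
  induction n with
  | zero => rfl
  | succ n ih =>
    rw [Nat.mul_succ, Finset.prod_range_succ, Finset.prod_range_succ, ih,
      Finset.prod_range_succ _ n, mul_assoc]

/-- Where `R ∘ T` expands by `σ`, the map `T` itself expands by `σ / C`. -/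
theorem ofReal_singularValues_le_eRan {𝕜 : Type u₁} [RCLike 𝕜]
    {X : Type u₂} [NormedAddCommGroup X] [NormedSpace 𝕜 X] [NormedSpace ℝ X] [IsScalarTower ℝ 𝕜 X]
    {F : Set X} (hF : Convex ℝ F) (hneg : ∀ f ∈ F, -f ∈ F)
    {U Z : Type*} [NormedAddCommGroup U] [InnerProductSpace 𝕜 U] [FiniteDimensional 𝕜 U]
    [NormedAddCommGroup Z] [InnerProductSpace 𝕜 Z] [FiniteDimensional 𝕜 Z]
    (T : U →ₗ[𝕜] X) (hT : ∀ a, ‖a‖ ≤ 1 → T a ∈ F) (R : X →ₗ[𝕜] Z) {C : ℝ} (hC : 0 < C)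
    (hR : ∀ g, ‖R g‖ ≤ C * ‖g‖) {k : ℕ} (hk : 2 * k < Module.finrank 𝕜 U) :
    ENNReal.ofReal ((R ∘ₗ T).singularValues (2 * k)) ≤
      ENNReal.ofReal (3 * C) * eRan.{u₁, u₂, u₂, v} (ContinuousLinearMap.id 𝕜 X) F k := by
  obtain ⟨W, hW, hlow⟩ := (R ∘ₗ T).exists_submodule_singularValues_mul_norm_le hk
  have h0 := (R ∘ₗ T).singularValues_nonneg (2 * k)
  have := ofReal_div_three_le_eRan.{u₁, u₂, u₂, v} (ContinuousLinearMap.id 𝕜 X) hF hneg hW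
    (T ∘ₗ W.subtype) (fun a ha => hT _ ha) (div_nonneg h0 hC.le) (fun a => by
      rw [div_mul_eq_mul_div, div_le_iff₀ hC]
      exact (hlow a a.2).trans ((hR _).trans_eq (mul_comm _ _)))
  calc ENNReal.ofReal ((R ∘ₗ T).singularValues (2 * k))
      = ENNReal.ofReal (3 * C) * ENNReal.ofReal ((R ∘ₗ T).singularValues (2 * k) / C / 3) := by
        rw [← ENNReal.ofReal_mul (by positivity)]
        congr 1
        field_simp
    _ ≤ _ := mul_le_mul' le_rfl this

/-- The singular values of index `2k` and `2k + 1` are both bounded through the even one, whence the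
square. -/
theorem ofReal_normDet_le_prod_eRan {𝕜 : Type u₁} [RCLike 𝕜]
    {X : Type u₂} [NormedAddCommGroup X] [NormedSpace 𝕜 X] [NormedSpace ℝ X] [IsScalarTower ℝ 𝕜 X]
    {F : Set X} (hF : Convex ℝ F) (hneg : ∀ f ∈ F, -f ∈ F)
    {U Z : Type*} [NormedAddCommGroup U] [InnerProductSpace 𝕜 U] [FiniteDimensional 𝕜 U]
    [NormedAddCommGroup Z] [InnerProductSpace 𝕜 Z] [FiniteDimensional 𝕜 Z]
    (T : U →ₗ[𝕜] X) (hT : ∀ a, ‖a‖ ≤ 1 → T a ∈ F) (R : X →ₗ[𝕜] Z) {C : ℝ} (hC : 0 < C)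
    (hR : ∀ g, ‖R g‖ ≤ C * ‖g‖) {n : ℕ} (hn : Module.finrank 𝕜 U = 2 * n) :
    ENNReal.ofReal (R ∘ₗ T).normDet ≤ (ENNReal.ofReal (3 * C) ^ n *
      ∏ k ∈ Finset.range n, eRan.{u₁, u₂, u₂, v} (ContinuousLinearMap.id 𝕜 X) F k) ^ 2 := by
  have h0 := (R ∘ₗ T).singularValues_nonneg
  rw [LinearMap.normDet_eq_prod_singularValues, hn, Finset.prod_range_two_mul,
    ENNReal.ofReal_prod_of_nonneg fun k _ => mul_nonneg (h0 _) (h0 _)]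
  have h1 : ENNReal.ofReal (3 * C) ^ n = ∏ k ∈ Finset.range n, ENNReal.ofReal (3 * C) := by simp
  rw [h1, ← Finset.prod_mul_distrib, ← Finset.prod_pow]
  refine Finset.prod_le_prod' fun k hk => ?_
  have hk' : 2 * k < Module.finrank 𝕜 U := by
    rw [hn]
    have := Finset.mem_range.1 hk
    omega
  have h2 := ofReal_singularValues_le_eRan.{u₁, u₂, v} hF hneg T hT R hC hR hk'
  rw [ENNReal.ofReal_mul (h0 _), sq]
  exact mul_le_mul' h2 (le_trans (ENNReal.ofReal_le_ofReal
    ((R ∘ₗ T).singularValues_antitone (Nat.le_succ _))) h2)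

/-! ### Greedy interpolation and determinants -/

theorem linSamplingNumber_antitone {𝕜 : Type*} [RCLike 𝕜] {D : Type*} [Nonempty D]
    (F : Set (BddFun 𝕜 D)) : Antitone (linSamplingNumber F) := by
  refine antitone_nat_of_succ_le fun n => le_iInf fun x => le_iInf fun φ => ?_
  obtain ⟨x₀⟩ := ‹Nonempty D›
  refine iInf_le_of_le (Fin.snoc (α := fun _ => D) x x₀)
    (iInf_le_of_le (Fin.snoc (α := fun _ => BddFun 𝕜 D) φ 0) (le_of_eq ?_))
  simp only [Fin.sum_univ_castSucc, Fin.snoc_castSucc, Fin.snoc_last, smul_zero, add_zero]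

/-- Bordering the matrix `(f i (x l))` multiplies its determinant by the interpolation error. -/
theorem det_snoc_eq_det_mul_interpolation_error {𝕜 : Type*} [Field 𝕜] {D : Type*} {j : ℕ}
    (f : Fin j → D → 𝕜) (x : Fin j → D) (g : D → 𝕜) (y : D)
    (hdet : (Matrix.of fun i l => f i (x l)).det ≠ 0) :
    (Matrix.of fun i l => (Fin.snoc (α := fun _ => D → 𝕜) f g i : D → 𝕜)
      (Fin.snoc (α := fun _ => D) x y l)).det =
    (Matrix.of fun i l => f i (x l)).det *
      (g y - ∑ l, g (x l) * ∑ i, (Matrix.of fun i l => f i (x l))⁻¹ l i * f i y) := by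
  set M : Matrix (Fin j) (Fin j) 𝕜 := Matrix.of fun i l => f i (x l) with hM
  let _ : Invertible M := M.invertibleOfIsUnitDet (isUnit_iff_ne_zero.2 hdet)
  rw [← Matrix.det_submatrix_equiv_self (finSumFinEquiv (m := j) (n := 1))]
  have : (Matrix.of fun i l => (Fin.snoc (α := fun _ => D → 𝕜) f g i : D → 𝕜)
      (Fin.snoc (α := fun _ => D) x y l)).submatrix (finSumFinEquiv (m := j) (n := 1))
        (finSumFinEquiv (m := j) (n := 1)) =
      Matrix.fromBlocks M (Matrix.of fun i _ => f i y) (Matrix.of fun _ l => g (x l))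
        (Matrix.of fun _ _ => g y) := by
    have h1 : ∀ i : Fin j, Fin.castAdd 1 i = i.castSucc := fun i => rfl
    have h2 : ∀ i : Fin 1, Fin.natAdd j i = Fin.last j := fun i => by
      rw [Subsingleton.elim i 0]; rfl
    ext (i | i) (l | l) <;>
      simp [hM, h1, h2]
  -- The Schur complement of `M` is the interpolation error at `y`.
  rw [this, Matrix.det_fromBlocks₁₁, Matrix.det_fin_one]
  congr 1
  simp only [Matrix.sub_apply, Matrix.of_apply, Matrix.mul_assoc, Matrix.mul_apply,
    Matrix.invOf_eq_nonsing_inv]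

theorem linSamplingNumber_le_of_det_le {𝕜 : Type*} [RCLike 𝕜] {D : Type*} [Nonempty D]
    (F : Set (BddFun 𝕜 D)) {m : ℕ} (hm : m ≠ 0) (b : ℝ≥0∞)
    (hb : ∀ (f : Fin m → BddFun 𝕜 D) (x : Fin m → D), (∀ i, f i ∈ F) →
      ‖(Matrix.of fun i l => f i (x l)).det‖ₑ ≤ b ^ m) :
    linSamplingNumber F (m - 1) ≤ b := by
  refine le_of_forall_gt fun c hc => ?_
  by_contra! hlt
  -- A finite constant strictly below the sampling number lets `g` and `y` be chosen although the
  -- suprema need not be attained.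
  obtain ⟨C, hbC, hCc⟩ := ENNReal.lt_iff_exists_nnreal_btwn.1 hc
  have hC : (0 : ℝ) < C := by
    have := (zero_le (a := b)).trans_lt hbC
    exact_mod_cast this
  have key : ∀ j ≤ m, ∃ (f : Fin j → BddFun 𝕜 D) (x : Fin j → D), (∀ i, f i ∈ F) ∧
      (C : ℝ) ^ j ≤ ‖(Matrix.of fun i l => f i (x l)).det‖ := by
    intro j
    induction j with
    | zero => exact fun _ => ⟨Fin.elim0, Fin.elim0, fun i => i.elim0, by simp⟩
    | succ j ih =>
      intro hj
      obtain ⟨f, x, hf, hdet⟩ := ih (by omega)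
      set M : Matrix (Fin j) (Fin j) 𝕜 := Matrix.of fun i l => f i (x l) with hM
      have hdet0 : M.det ≠ 0 := norm_pos_iff.1 ((pow_pos hC j).trans_le hdet)
      -- Interpolation in `x` by the span of the `f i` is one of the competitors with `j ≤ m - 1`
      -- points.
      have h1 : (C : ℝ≥0∞) < ⨆ g ∈ F, ‖g - ∑ l, g (x l) • ∑ i, M⁻¹ l i • f i‖ₑ := by
        refine (hCc.trans_le hlt).trans_le
          ((linSamplingNumber_antitone F (by omega : j ≤ m - 1)).trans ?_)
        exact iInf_le_of_le x (iInf_le _ fun l => ∑ i, M⁻¹ l i • f i)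
      simp only [lt_iSup_iff] at h1
      obtain ⟨g, hg, h1⟩ := h1
      have h2 : (C : ℝ) < ‖g - ∑ l, g (x l) • ∑ i, M⁻¹ l i • f i‖ := by
        rw [← ofReal_norm, ← ENNReal.ofReal_coe_nnreal] at h1
        exact (ENNReal.ofReal_lt_ofReal_iff_of_nonneg hC.le).1 h1
      obtain ⟨y, hy⟩ : ∃ y, (C : ℝ) < ‖(g - ∑ l, g (x l) • ∑ i, M⁻¹ l i • f i : BddFun 𝕜 D) y‖ := by
        by_contra! h
        exact h2.not_ge (lp.norm_le_of_forall_le hC.le h)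
      refine ⟨Fin.snoc (α := fun _ => BddFun 𝕜 D) f g, Fin.snoc (α := fun _ => D) x y,
        fun i => ?_, ?_⟩
      · refine Fin.lastCases ?_ (fun i => ?_) i
        · simpa using hg
        · simpa using hf i
      have h3 := det_snoc_eq_det_mul_interpolation_error (fun i => (f i : D → 𝕜)) x g y hdet0
      have h4 : (Matrix.of fun i l => (Fin.snoc (α := fun _ => BddFun 𝕜 D) f g i : BddFun 𝕜 D)
          (Fin.snoc (α := fun _ => D) x y l)) =
          (Matrix.of fun i l => (Fin.snoc (α := fun _ => D → 𝕜) (fun i => (f i : D → 𝕜)) g i :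
            D → 𝕜) (Fin.snoc (α := fun _ => D) x y l)) := by
        ext i l
        refine Fin.lastCases ?_ (fun i => ?_) i <;> simp
      rw [h4, h3, norm_mul, pow_succ]
      refine mul_le_mul hdet (hy.le.trans_eq ?_) hC.le (norm_nonneg _)
      congr 1
      simp only [lp.coeFn_sub, lp.coeFn_sum, lp.coeFn_smul, Pi.sub_apply, Finset.sum_apply,
        Pi.smul_apply, smul_eq_mul, hM]
  obtain ⟨f, x, hf, hdet⟩ := key m le_rfl
  have h1 := hb f x hf
  rw [← ofReal_norm] at h1
  have h2 : (C : ℝ≥0∞) ^ m ≤ b ^ m := by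
    refine le_trans ?_ h1
    rw [← ENNReal.ofReal_coe_nnreal, ← ENNReal.ofReal_pow hC.le]
    exact ENNReal.ofReal_le_ofReal hdet
  exact absurd (ENNReal.pow_lt_pow_left hm hbC) h2.not_gt

/-! ### Determinant bounds for the two classes -/

/-- Evaluation of a bounded function at finitely many points. -/
noncomputable def evalPoints (𝕜 : Type*) [RCLike 𝕜] {D : Type*} {m : ℕ} (x : Fin m → D) :
    BddFun 𝕜 D →ₗ[𝕜] EuclideanSpace 𝕜 (Fin m) where
  toFun g := WithLp.toLp 2 fun l => g (x l)
  map_add' _ _ := rfl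
  map_smul' _ _ := rfl

theorem evalPoints_apply {𝕜 : Type*} [RCLike 𝕜] {D : Type*} {m : ℕ} (x : Fin m → D)
    (g : BddFun 𝕜 D) (l : Fin m) : evalPoints 𝕜 x g l = g (x l) := rfl

theorem norm_evalPoints_le {𝕜 : Type*} [RCLike 𝕜] {D : Type*} {m : ℕ} (x : Fin m → D)
    (g : BddFun 𝕜 D) : ‖evalPoints 𝕜 x g‖ ≤ √m * ‖g‖ := by
  rw [EuclideanSpace.norm_eq, Real.sqrt_le_left (by positivity), mul_pow,
    Real.sq_sqrt (Nat.cast_nonneg m)]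
  calc ∑ l, ‖evalPoints 𝕜 x g l‖ ^ 2 ≤ ∑ _l : Fin m, ‖g‖ ^ 2 := by
        refine Finset.sum_le_sum fun l _ => ?_
        gcongr
        exact lp.norm_apply_le_norm ENNReal.top_ne_zero g (x l)
    _ = m * ‖g‖ ^ 2 := by simp

theorem normDet_evalPoints_comp {𝕜 : Type*} [RCLike 𝕜] {D : Type*} {m : ℕ} (x : Fin m → D)
    {U : Type*} [NormedAddCommGroup U] [InnerProductSpace 𝕜 U] [FiniteDimensional 𝕜 U]
    (b : OrthonormalBasis (Fin m) 𝕜 U) (T : U →ₗ[𝕜] BddFun 𝕜 D) :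
    (evalPoints 𝕜 x ∘ₗ T).normDet = ‖(Matrix.of fun i l => T (b i) (x l)).det‖ := by
  rw [LinearMap.normDet_eq_norm_det_toMatrix _ b (EuclideanSpace.basisFun (Fin m) 𝕜),
    ← Matrix.det_transpose]
  congr 2
  ext i l
  simp [LinearMap.toMatrix_apply, evalPoints_apply]

/-- Phases of the coefficients are absorbed by symmetry, moduli by convexity and `0 ∈ F`. -/
theorem sum_smul_mem_of_symmetric {𝕜 : Type*} [RCLike 𝕜] {X : Type*} [NormedAddCommGroup X]
    [NormedSpace 𝕜 X] [NormedSpace ℝ X] [IsScalarTower ℝ 𝕜 X] {F : Set X} (hF : Convex ℝ F)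
    (hsymm : SymmetricSet 𝕜 F) {ι : Type*} (s : Finset ι) (c : ι → 𝕜)
    {f : ι → X} (hf : ∀ i, f i ∈ F) (h0 : (0 : X) ∈ F) (hc : ∑ i ∈ s, ‖c i‖ ≤ 1) :
    ∑ i ∈ s, c i • f i ∈ F := by
  have h1 : ∀ i, ∃ g ∈ F, c i • f i = ‖c i‖ • g := fun i => by
    rcases eq_or_ne (c i) 0 with h | h
    · exact ⟨f i, hf i, by simp [h]⟩
    · refine ⟨(c i / (‖c i‖ : 𝕜)) • f i, hsymm _ ?_ _ (hf i), ?_⟩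
      · rw [norm_div, RCLike.norm_ofReal, abs_norm, div_self (norm_ne_zero_iff.2 h)]
      · rw [← smul_assoc, RCLike.real_smul_eq_coe_mul, mul_div_cancel₀]
        exact_mod_cast norm_ne_zero_iff.2 h
  choose g hg hfg using h1
  simp_rw [hfg]
  rcases (Finset.sum_nonneg fun i _ => norm_nonneg (c i) : 0 ≤ ∑ i ∈ s, ‖c i‖).eq_or_lt with h | h
  · have : ∀ i ∈ s, ‖c i‖ = 0 :=
      (Finset.sum_eq_zero_iff_of_nonneg fun i _ => norm_nonneg _).1 h.symm
    rwa [Finset.sum_eq_zero fun i hi => by rw [this i hi, zero_smul]]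
  · have h3 : (∑ i ∈ s, ‖c i‖)⁻¹ • ∑ i ∈ s, ‖c i‖ • g i ∈ F := by
      rw [Finset.smul_sum]
      simp_rw [smul_smul]
      refine hF.sum_mem (fun i _ => by positivity) ?_ fun i _ => hg i
      rw [← Finset.mul_sum, inv_mul_cancel₀ h.ne']
    have := hF.smul_mem_of_zero_mem h0 h3 ⟨h.le, hc⟩
    rwa [smul_inv_smul₀ h.ne'] at this

theorem sum_norm_le_sqrt_mul_norm {𝕜 : Type*} [RCLike 𝕜] {m : ℕ} (a : EuclideanSpace 𝕜 (Fin m)) :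
    ∑ i, ‖a i‖ ≤ √m * ‖a‖ := by
  refine Real.le_sqrt_of_sq_le ?_ |>.trans_eq (b := √(m * ‖a‖ ^ 2)) ?_
  · rw [EuclideanSpace.norm_sq_eq]
    simpa using sq_sum_le_card_mul_sum_sq (s := Finset.univ) (f := fun i => ‖a i‖)
  · rw [Real.sqrt_mul (Nat.cast_nonneg m), Real.sqrt_sq (norm_nonneg a)]

theorem enorm_det_le_of_convex_symmetric {𝕜 : Type u₁} [RCLike 𝕜] {D : Type u₂}
    {F : Set (BddFun 𝕜 D)} (hF : Convex ℝ F) (hsymm : SymmetricSet 𝕜 F) {n : ℕ} (hn : 1 ≤ n)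
    (f : Fin (2 * n) → BddFun 𝕜 D) (x : Fin (2 * n) → D) (hf : ∀ i, f i ∈ F) :
    ‖(Matrix.of fun i l => f i (x l)).det‖ₑ ≤ (ENNReal.ofReal (6 * n) ^ n *
      ∏ k ∈ Finset.range n,
        eRan.{u₁, max u₁ u₂, max u₁ u₂, v} (appInfty 𝕜 D) F k) ^ 2 := by
  have hneg : ∀ g ∈ F, -g ∈ F := fun g hg => by
    simpa using hsymm (-1) (by simp) g hg
  have h0 : (0 : BddFun 𝕜 D) ∈ F := by
    have := hF (hf ⟨0, by omega⟩) (hneg _ (hf ⟨0, by omega⟩)) (a := 1 / 2) (b := 1 / 2)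
      (by norm_num) (by norm_num) (by norm_num)
    simpa using this
  have hm : (0 : ℝ) < (2 * n : ℕ) := by exact_mod_cast (by omega : 0 < 2 * n)
  have hs : 0 < √(2 * n : ℕ) := Real.sqrt_pos.2 hm
  -- By Cauchy-Schwarz, the factor `1 / √(2n)` brings the `ℓ¹` norm of the coefficients below one on
  -- the Euclidean unit ball.
  let T : EuclideanSpace 𝕜 (Fin (2 * n)) →ₗ[𝕜] BddFun 𝕜 D :=
    (((√(2 * n : ℕ))⁻¹ : ℝ) : 𝕜) • (Fintype.linearCombination 𝕜 f ∘ₗ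
      (WithLp.linearEquiv 2 𝕜 (Fin (2 * n) → 𝕜)).toLinearMap)
  have hTa : ∀ a, T a = ∑ i, ((((√(2 * n : ℕ))⁻¹ : ℝ) : 𝕜) * a i) • f i := fun a => by
    change (((√(2 * n : ℕ))⁻¹ : ℝ) : 𝕜) • ∑ i, a i • f i = _
    simp_rw [Finset.smul_sum, smul_smul]
  have hT : ∀ a, ‖a‖ ≤ 1 → T a ∈ F := fun a ha => by
    rw [hTa]
    refine sum_smul_mem_of_symmetric hF hsymm _ _ hf h0 ?_
    simp_rw [norm_mul]
    rw [← Finset.mul_sum, RCLike.norm_ofReal, abs_of_pos (inv_pos.2 hs), inv_mul_le_iff₀ hs]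
    exact (sum_norm_le_sqrt_mul_norm a).trans (mul_le_mul_of_nonneg_left ha hs.le)
  have key := ofReal_normDet_le_prod_eRan.{u₁, max u₁ u₂, v} hF hneg T hT (evalPoints 𝕜 x) hs
    (norm_evalPoints_le x) finrank_euclideanSpace_fin
  rw [normDet_evalPoints_comp x (EuclideanSpace.basisFun _ 𝕜)] at key
  have hdet : (Matrix.of fun i l => f i (x l)).det = ((√(2 * n : ℕ) : ℝ) : 𝕜) ^ (2 * n) *
      (Matrix.of fun i l => T (EuclideanSpace.basisFun _ 𝕜 i) (x l)).det := by
    have : (Matrix.of fun i l => f i (x l)) = ((√(2 * n : ℕ) : ℝ) : 𝕜) •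
        (Matrix.of fun i l => T (EuclideanSpace.basisFun _ 𝕜 i) (x l)) := by
      ext i l
      have h1 : T (EuclideanSpace.basisFun _ 𝕜 i) = (((√(2 * n : ℕ))⁻¹ : ℝ) : 𝕜) • f i := by
        rw [hTa, Finset.sum_eq_single i]
        · rw [EuclideanSpace.basisFun_apply, PiLp.single_apply, if_pos rfl, mul_one]
        · intro j _ hj
          rw [EuclideanSpace.basisFun_apply, PiLp.single_apply, if_neg hj, mul_zero, zero_smul]
        · exact fun h => absurd (Finset.mem_univ i) h
      rw [Matrix.smul_apply, Matrix.of_apply, Matrix.of_apply, h1, lp.coeFn_smul, Pi.smul_apply,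
        smul_smul, ← RCLike.ofReal_mul, mul_inv_cancel₀ hs.ne', RCLike.ofReal_one, one_smul]
    rw [this, Matrix.det_smul, Fintype.card_fin]
  rw [← ofReal_norm, hdet, norm_mul, norm_pow, RCLike.norm_ofReal, abs_of_pos hs,
    ENNReal.ofReal_mul (by positivity)]
  refine (mul_le_mul' le_rfl key).trans_eq ?_
  have hpow : ENNReal.ofReal (√(2 * n : ℕ) ^ (2 * n)) = (ENNReal.ofReal √(2 * n : ℕ) ^ n) ^ 2 := by
    rw [ENNReal.ofReal_pow hs.le, ← pow_mul, mul_comm n 2]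
  rw [hpow, ← mul_pow, ← mul_assoc, ← mul_pow, ← ENNReal.ofReal_mul hs.le]
  congr 4
  rw [mul_left_comm, Real.mul_self_sqrt (Nat.cast_nonneg _)]
  push_cast
  ring

/-- Hadamard's inequality: in the Gram-Schmidt basis the determinant is a product of inner products
of unit vectors with the `h i`. -/
theorem norm_det_toMatrix_gramSchmidt_le {𝕜 : Type*} [RCLike 𝕜] {U : Type*}
    [NormedAddCommGroup U] [InnerProductSpace 𝕜 U] [FiniteDimensional 𝕜 U] {m : ℕ}
    (hU : Module.finrank 𝕜 U = m) (h : Fin m → U) (hh : ∀ i, ‖h i‖ ≤ 1) :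
    ∃ b : OrthonormalBasis (Fin m) 𝕜 U, ‖(b.toBasis.toMatrix h).det‖ ≤ 1 := by
  have hU' : Module.finrank 𝕜 U = Fintype.card (Fin m) := by rw [hU, Fintype.card_fin]
  set b := InnerProductSpace.gramSchmidtOrthonormalBasis hU' h with hb
  refine ⟨b, ?_⟩
  rw [← Module.Basis.det_apply, hb, InnerProductSpace.gramSchmidtOrthonormalBasis_det, norm_prod]
  refine Finset.prod_le_one (fun i _ => norm_nonneg _) fun i _ => ?_
  refine (norm_inner_le_norm _ _).trans ?_
  rw [OrthonormalBasis.norm_eq_one, one_mul]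
  exact hh i

theorem enorm_det_le_of_hilbert {𝕜 : Type u₁} [RCLike 𝕜] {D : Type u₂}
    {H : Type*} [NormedAddCommGroup H] [InnerProductSpace 𝕜 H] (J : H →L[𝕜] BddFun 𝕜 D)
    {n : ℕ} (hn : 1 ≤ n) (f : Fin (2 * n) → BddFun 𝕜 D) (x : Fin (2 * n) → D)
    (hf : ∀ i, f i ∈ J '' Metric.closedBall 0 1) :
    ‖(Matrix.of fun i l => f i (x l)).det‖ₑ ≤ (ENNReal.ofReal (6 * √n) ^ n *
      ∏ k ∈ Finset.range n, eRan.{u₁, max u₁ u₂, max u₁ u₂, v} (appInfty 𝕜 D)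
        (J '' Metric.closedBall 0 1) k) ^ 2 := by
  choose h hh hJ using hf
  simp only [mem_closedBall_zero_iff] at hh
  set M : Matrix (Fin (2 * n)) (Fin (2 * n)) 𝕜 := Matrix.of fun i l => f i (x l) with hM
  by_cases hli : LinearIndependent 𝕜 h
  swap
  · have : M.det = 0 := by
      obtain ⟨c, hc, i, hi⟩ := Fintype.not_linearIndependent_iff.1 hli
      refine Matrix.exists_vecMul_eq_zero_iff.1 ⟨c, fun h0 => hi (by rw [h0]; rfl), ?_⟩
      ext l
      have h1 := congrArg (fun g => evalPoints 𝕜 x (J g) l) hc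
      simp only [map_sum, map_smul, hJ, map_zero] at h1
      simpa [Matrix.vecMul, dotProduct, evalPoints_apply, hM] using h1
    rw [this]
    simp
  set U := Submodule.span 𝕜 (Set.range h) with hUdef
  have : FiniteDimensional 𝕜 U := FiniteDimensional.span_of_finite 𝕜 (Set.finite_range h)
  have hU : Module.finrank 𝕜 U = 2 * n := by
    rw [hUdef, finrank_span_eq_card hli, Fintype.card_fin]
  let h' : Fin (2 * n) → U := fun i => ⟨h i, Submodule.subset_span ⟨i, rfl⟩⟩
  obtain ⟨b, hb⟩ := norm_det_toMatrix_gramSchmidt_le hU h' hh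
  have hm : (0 : ℝ) < (2 * n : ℕ) := by exact_mod_cast (by omega : 0 < 2 * n)
  have hs : 0 < √(2 * n : ℕ) := Real.sqrt_pos.2 hm
  let _ : NormedSpace ℝ H := NormedSpace.restrictScalars ℝ 𝕜 H
  have hF : Convex ℝ (J '' Metric.closedBall 0 1) := by
    rintro _ ⟨p, hp, rfl⟩ _ ⟨q, hq, rfl⟩ s t hs ht hst
    refine ⟨s • p + t • q, convex_closedBall 0 1 hp hq hs ht hst, ?_⟩
    rw [map_add]
    congr 1
    · exact (J.map_smul (s : 𝕜) p).trans (RCLike.real_smul_eq_coe_smul (K := 𝕜) s (J p)).symm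
    · exact (J.map_smul (t : 𝕜) q).trans (RCLike.real_smul_eq_coe_smul (K := 𝕜) t (J q)).symm
  have hneg : ∀ g ∈ J '' Metric.closedBall 0 1, -g ∈ J '' Metric.closedBall 0 1 := by
    rintro _ ⟨p, hp, rfl⟩
    exact ⟨-p, by simpa using hp, map_neg J p⟩
  have key := ofReal_normDet_le_prod_eRan.{u₁, max u₁ u₂, v} hF hneg
    (J.toLinearMap ∘ₗ U.subtype) (fun a ha => ⟨a, by simpa using ha, rfl⟩) (evalPoints 𝕜 x) hs
    (norm_evalPoints_le x) hU
  rw [normDet_evalPoints_comp x b] at key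
  -- Passing from the `h i` to an orthonormal basis of their span costs only a factor of modulus at
  -- most one.
  have hdet : M = (b.toBasis.toMatrix h').transpose *
      Matrix.of fun i l => (J.toLinearMap ∘ₗ U.subtype) (b i) (x l) := by
    ext i l
    have h1 : f i = ∑ j, b.toBasis.toMatrix h' j i • (J.toLinearMap ∘ₗ U.subtype) (b j) := by
      rw [← hJ]
      have h2 := b.toBasis.sum_toMatrix_smul_self h' i
      have h3 := congrArg (J.toLinearMap ∘ₗ U.subtype) h2
      rw [map_sum] at h3
      simp only [map_smul, OrthonormalBasis.coe_toBasis] at h3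
      exact h3.symm
    rw [hM, Matrix.of_apply, h1, Matrix.mul_apply]
    simp only [lp.coeFn_sum, lp.coeFn_smul, Finset.sum_apply, Pi.smul_apply, smul_eq_mul,
      Matrix.transpose_apply, Matrix.of_apply]
  rw [hdet, Matrix.det_mul, Matrix.det_transpose, ← ofReal_norm, norm_mul]
  refine (ENNReal.ofReal_le_ofReal (mul_le_of_le_one_left (norm_nonneg _) hb)).trans
    (key.trans ?_)
  gcongr ?_ ^ 2
  refine mul_le_mul' (pow_le_pow_left₀ zero_le (ENNReal.ofReal_le_ofReal ?_) n) le_rfl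
  have h4 : √(2 * n : ℕ) ≤ 2 * √n := by
    rw [Real.sqrt_le_left (by positivity), mul_pow, Real.sq_sqrt (Nat.cast_nonneg n)]
    push_cast
    linarith [Nat.cast_nonneg (α := ℝ) n]
  linarith

/-! ### Conclusion -/

theorem linSamplingNumber_le_of_det_le_sq {𝕜 : Type*} [RCLike 𝕜] {D : Type*} [Nonempty D]
    (F : Set (BddFun 𝕜 D)) {n : ℕ} (hn : 1 ≤ n) (c p : ℝ≥0∞)
    (hb : ∀ (f : Fin (2 * n) → BddFun 𝕜 D) (x : Fin (2 * n) → D), (∀ i, f i ∈ F) →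
      ‖(Matrix.of fun i l => f i (x l)).det‖ₑ ≤ (c ^ n * p) ^ 2) :
    linSamplingNumber F (2 * n - 1) ≤ c * p ^ (1 / (n : ℝ)) := by
  refine linSamplingNumber_le_of_det_le F (by omega) _ fun f x hf => (hb f x hf).trans_eq ?_
  rw [mul_comm 2 n, pow_mul, mul_pow c _ n, ← ENNReal.rpow_mul_natCast, one_div,
    inv_mul_cancel₀ (by exact_mod_cast (by omega : n ≠ 0)), ENNReal.rpow_one]

theorem mainTheorem3 {𝕜 : Type u₁} [RCLike 𝕜] {D : Type u₂} [Nonempty D]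
    (F : Set (BddFun 𝕜 D)) (n : ℕ) (hn : 1 ≤ n) :
    (Convex ℝ F → SymmetricSet 𝕜 F →
      linSamplingNumber F (2 * n - 1) ≤
        6 * (n : ℝ≥0∞) *
          (∏ k ∈ Finset.range n, eRan.{u₁, max u₁ u₂, max u₁ u₂, v} (appInfty 𝕜 D) F k) ^ (1 / (n : ℝ))) ∧
    (IsHilbertUnitBall.{u₁, u₂, w} F →
      linSamplingNumber F (4 * n - 1) ≤
        6 * (n : ℝ≥0∞) ^ (1 / 2 : ℝ) *
          (∏ k ∈ Finset.range n, eRan.{u₁, max u₁ u₂, max u₁ u₂, v} (appInfty 𝕜 D) F k) ^ (1 / (n : ℝ))) := by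
  constructor
  · intro hF hsymm
    have h6 : ENNReal.ofReal (6 * n) = 6 * (n : ℝ≥0∞) := by
      rw [ENNReal.ofReal_mul (by norm_num), ENNReal.ofReal_natCast, ENNReal.ofReal_ofNat]
    rw [← h6]
    exact linSamplingNumber_le_of_det_le_sq F hn _ _
      (enorm_det_le_of_convex_symmetric hF hsymm hn)
  · rintro ⟨H, _, _, _, J, -, rfl⟩
    have h6 : ENNReal.ofReal (6 * √n) = 6 * (n : ℝ≥0∞) ^ (1 / 2 : ℝ) := by
      rw [ENNReal.ofReal_mul (by norm_num), ENNReal.ofReal_ofNat, Real.sqrt_eq_rpow,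
        ← ENNReal.ofReal_rpow_of_nonneg (Nat.cast_nonneg n) (by norm_num), ENNReal.ofReal_natCast]
    rw [← h6]
    -- The Hilbert bound already holds with `2n - 1` points; more points only help.
    exact (linSamplingNumber_antitone _ (by omega : 2 * n - 1 ≤ 4 * n - 1)).trans
      (linSamplingNumber_le_of_det_le_sq _ hn _ _ (enorm_det_le_of_hilbert J hn))
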